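/- Let $\mathfrak H$ be a complex Hilbert space and let $J,R$ be bounded operators in $\mathfrak H$ with $J=J^*$, $J^2=I$, $R=R^*$, $R^2=I$ and $JR+RJ=0$. Let $S$ be a densely defined symmetric operator in $\mathfrak H$ that is simple (it has no nonzero reducing subspace in which it induces a self-adjoint operator), has defect numbers $\langle 2,2\rangle$ (i.e. $\dim\ker(S^*-iI)=\dim\ker(S^*+iI)=2$), and commutes with $J$ and $R$ ($SJ=JS$, $SR=RS$, domains included). Let $\{C_\alpha\}_{\alpha\in D}$ be the collection of all bounded linear operators $C$ in $\mathfrak H$ such that $C^2=I$, $JC>0$ (that is, $JC$ is self-adjoint and $(JCx,x)>0$ for $x\neq0$) and $SC=CS$. Let $\Upsilon$ be the set of all operators $A\supset S$ with $A^*J=JA$ and $AC_\alpha=C_\alpha A$ for every $\alpha\in D$, and assume that $\Upsilon\neq\emptyset$. Let $(\mathcal H,\Gamma_0,\Gamma_1)$ be a boundary triplet of $S^*$, i.e. $\mathcal H$ is a complex Hilbert space and $\Gamma_0,\Gamma_1:\mathcal D(S^*)\to\mathcal H$ are linear maps such that $$(S^*x,y)-(x,S^*y)=(\Gamma_1x,\Gamma_0y)_{\mathcal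 H}-(\Gamma_0x,\Gamma_1y)_{\mathcal H},\qquad x,y\in\mathcal D(S^*),$$ and $(\Gamma_0,\Gamma_1):\mathcal D(S^*)\to\mathcal H\oplus\mathcal H$ is surjective. For a bounded operator $C$ in $\mathfrak H$, say that the formulas $\mathcal C\,\Gamma_j=\Gamma_jC$ ($j=0,1$) correctly define an operator $\mathcal C$ in $\mathcal H$ if there is a unique bounded linear operator $\mathcal C$ in $\mathcal H$ such that, for all $f\in\mathcal D(S^*)$, $Cf\in\mathcal D(S^*)$ and $\mathcal C\,\Gamma_jf=\Gamma_jCf$ for both $j=0$ and $j=1$. Then the formulas $$\mathcal C_\alpha\Gamma_0f=\Gamma_0C_\alpha f,\qquad \mathcal C_\alpha\Gamma_1f=\Gamma_1C_\alpha f,\qquad f\in\mathcal D(S^*),$$ correctly define an operator $\mathcal C_\alpha$ in $\mathcal H$ for every $\alpha\in D$ if and only if the formulas $$\mathcal J\,\Gamma_j=\Gamma_jJ,\qquad \mathcal R\,\Gamma_j=\Gamma_jR,\qquad j=0,1,$$ correctly define operators $\mathcal J$ and $\mathcal R$ in $\mathcal H$. -/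

import Mathlib

open scoped LinearPMap

noncomputable section

namespace KreinExt

variable {E F H : Type*}
  [NormedAddCommGroup E] [InnerProductSpace ℂ E]
  [NormedAddCommGroup F] [InnerProductSpace ℂ F]
  [NormedAddCommGroup H] [InnerProductSpace ℂ H]

/-- The product `A C` of a partially defined operator `A` with an everywhere defined operator `C`
on its right, with its natural domain `{x | C x ∈ D(A)}`. -/
def mulRight (A : E →ₗ.[ℂ] E) (C : F →ₗ[ℂ] E) : F →ₗ.[ℂ] E where
  domain := A.domain.comap C
  toFun := A.toFun ∘ₗ C.restrict (p := A.domain.comap C) (q := A.domain) (fun _ hx => hx)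

/-- The product `C A` of a partially defined operator `A` with an everywhere defined operator `C`
on its left; its domain is `D(A)`. -/
def mulLeft (C : E →ₗ[ℂ] F) (A : E →ₗ.[ℂ] E) : E →ₗ.[ℂ] F := C.compPMap A

/-- `[A, C] = 0`, that is, `A C = C A` as operators (equality of the domains included). -/
def Commutes (A : E →ₗ.[ℂ] E) (C : E →L[ℂ] E) : Prop :=
  mulRight A (C : E →ₗ[ℂ] E) = mulLeft (C : E →ₗ[ℂ] E) A

/-- A (densely defined) symmetric operator. -/
structure IsSymmetricOp (S : E →ₗ.[ℂ] E) : Prop where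
  dense : Dense (S.domain : Set E)
  symm : S.IsFormalAdjoint S

variable [CompleteSpace E]

/-- A fundamental symmetry: `J = J*` and `J² = I`. -/
structure IsFundamentalSymmetry (J : E →L[ℂ] E) : Prop where
  selfAdjoint : IsSelfAdjoint J
  sq : J * J = 1

/-- The strict positivity `T > 0` of a bounded operator: `T` is self-adjoint and
`(T x, x) > 0` for `x ≠ 0`. -/
def IsStrictlyPos (T : E →L[ℂ] E) : Prop :=
  IsSelfAdjoint T ∧ ∀ x : E, x ≠ 0 → 0 < T.reApplyInnerSelf x

/-- The eigenspace `ker (S* - μ I)`, a subspace of the domain of `S*`. -/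
def defectSpace (S : E →ₗ.[ℂ] E) (μ : ℂ) : Submodule ℂ S†.domain :=
  LinearMap.ker (S†.toFun - μ • S†.domain.subtype)

/-- `S` has defect numbers `⟨n, m⟩`. For `n, m ≠ 0`, the only case used, `finrank` is the honest
dimension. -/
def HasDefectNumbers (S : E →ₗ.[ℂ] E) (n m : ℕ) : Prop :=
  Module.finrank ℂ (defectSpace S Complex.I) = n ∧
    Module.finrank ℂ (defectSpace S (-Complex.I)) = m

/-- The closed subspace `M` reduces `S`: for the orthogonal projection `P` onto `M` one has
`P S ⊆ S P`. -/
def Reduces (S : E →ₗ.[ℂ] E) (M : Submodule ℂ E) [CompleteSpace M] : Prop :=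
  mulLeft (M.starProjection : E →ₗ[ℂ] E) S ≤ mulRight S (M.starProjection : E →ₗ[ℂ] E)

/-- The part of `S` in `M`, with domain `D(S) ∩ M`, as an operator in the Hilbert space `M`
(if `M` reduces `S` then `S` maps `D(S) ∩ M` into `M`, and the projection changes nothing). -/
def partIn (S : E →ₗ.[ℂ] E) (M : Submodule ℂ E) [CompleteSpace M] : M →ₗ.[ℂ] M :=
  (M.orthogonalProjectionOnto : E →ₗ[ℂ] M).compPMap (mulRight S M.subtype)

/-- A symmetric operator is simple if it has no nonzero reducing subspace in which it induces
a self-adjoint operator. -/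
def IsSimpleOp (S : E →ₗ.[ℂ] E) : Prop :=
  ∀ (M : Submodule ℂ E) [CompleteSpace M],
    Reduces S M → IsSelfAdjoint (partIn S M) → M = ⊥

/-- The collection `{C_α}` of all bounded operators `C` with `C² = I`, `J C > 0`, `S C = C S`,
i.e. of all `C`-symmetries of `S` in the Krein space with fundamental symmetry `J`. -/
def cSymmetries (S : E →ₗ.[ℂ] E) (J : E →L[ℂ] E) : Set (E →L[ℂ] E) :=
  {C | C * C = 1 ∧ IsStrictlyPos (J * C) ∧ Commutes S C}

/-- The set `Σ_J` of all `J`-self-adjoint extensions `A` of `S`: `A ⊇ S` and `A* J = J A`. -/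
def jSelfAdjointExtensions (S : E →ₗ.[ℂ] E) (J : E →L[ℂ] E) : Set (E →ₗ.[ℂ] E) :=
  {A | S ≤ A ∧ mulRight A† (J : E →ₗ[ℂ] E) = mulLeft (J : E →ₗ[ℂ] E) A}

/-- The set `Υ` of all `J`-self-adjoint extensions of `S` that commute with every `C`-symmetry
of `S`. -/
def upsilonSet (S : E →ₗ.[ℂ] E) (J : E →L[ℂ] E) : Set (E →ₗ.[ℂ] E) :=
  {A | A ∈ jSelfAdjointExtensions S J ∧ ∀ C ∈ cSymmetries S J, Commutes A C}

/-- A boundary triplet `(H, Γ₀, Γ₁)` of `S*`. Mathlib's inner product is linear in the second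
variable, so `inner ℂ b a` is the product `(a, b)` that is linear in `a`. -/
structure BoundaryTriplet (S : E →ₗ.[ℂ] E) (H : Type*)
    [NormedAddCommGroup H] [InnerProductSpace ℂ H] where
  Γ₀ : S†.domain →ₗ[ℂ] H
  Γ₁ : S†.domain →ₗ[ℂ] H
  green : ∀ x y : S†.domain,
    inner ℂ (y : E) (S† x) - inner ℂ (S† y) (x : E) =
      inner ℂ (Γ₀ y) (Γ₁ x) - inner ℂ (Γ₁ y) (Γ₀ x)
  surj : Function.Surjective fun x => (Γ₀ x, Γ₁ x)

/-- `K Γⱼ f = Γⱼ C f` for `j = 0, 1` and all `f ∈ D(S*)`, including that `C f ∈ D(S*)`. -/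
def BoundaryTriplet.Intertwines {S : E →ₗ.[ℂ] E} (B : BoundaryTriplet S H)
    (C : E →L[ℂ] E) (K : H →L[ℂ] H) : Prop :=
  ∀ f : S†.domain, ∃ h : C (f : E) ∈ S†.domain,
    K (B.Γ₀ f) = B.Γ₀ ⟨C f, h⟩ ∧ K (B.Γ₁ f) = B.Γ₁ ⟨C f, h⟩

/-- The formulas `K Γⱼ = Γⱼ C`, `j = 0, 1`, correctly define an operator `K` in `H`, the boundary
image of `C`. -/
def BoundaryTriplet.HasImage {S : E →ₗ.[ℂ] E} (B : BoundaryTriplet S H)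
    (C : E →L[ℂ] E) : Prop :=
  ∃! K : H →L[ℂ] H, B.Intertwines C K

/-- Every `C`-symmetry `C_α` of `S` has a boundary image `𝒞_α`. -/
def BoundaryTriplet.HasIntertwiningProperty {S : E →ₗ.[ℂ] E} (B : BoundaryTriplet S H)
    (J : E →L[ℂ] E) : Prop :=
  ∀ C ∈ cSymmetries S J, B.HasImage C

end KreinExt

end

open scoped InnerProductSpace

/-! The bounded operators with a boundary image form an algebra, and so do those that map the graph
of a given operator into itself; everything reduces to finding generators.

If every `C`-symmetry has an image, so do `J` and `J e^{χR}`, which are `C`-symmetries, and `R` is a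
linear combination of `1` and `J · J e^{χR}` (`mem_of_cSymmetries_subset`).

Conversely, an `A ∈ Υ` commutes with `J`, hence is self-adjoint, and leaves `R` in its commutant. A
`C`-symmetry `C` preserves the two-dimensional space `ker (S* - i)`, where `J` and `R` generate all
of `M₂(ℂ)`; so `C` agrees there with some `P` in the algebra of `J` and `R`
(`exists_mem_adjoin_eqOn`). Since `D(S*) = D(A) + ker (S* - i)`, Green's formula shows that `C - P`
has boundary image `0` (`BoundaryTriplet.intertwines_zero`), so `C` has the image of `P`. -/

namespace KreinExt

/-! ### Commutants of unbounded operators, through graphs. -/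

section Algebra

variable {E : Type*} [NormedAddCommGroup E] [InnerProductSpace ℂ E]

/-- The algebra of the bounded operators `T` with `T A ⊆ A T`. -/
def commutant (A : E →ₗ.[ℂ] E) : Subalgebra ℂ (E →L[ℂ] E) where
  carrier := {T | ∀ x y, (x, y) ∈ A.graph → (T x, T y) ∈ A.graph}
  mul_mem' hT hU x y h := hT _ _ (hU _ _ h)
  add_mem' hT hU x y h := A.graph.add_mem (hT _ _ h) (hU _ _ h)
  algebraMap_mem' c x y h := by
    simpa [Algebra.algebraMap_eq_smul_one] using A.graph.smul_mem c h

theorem mem_commutant {A : E →ₗ.[ℂ] E} {T : E →L[ℂ] E} :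
    T ∈ commutant A ↔ ∀ x y, (x, y) ∈ A.graph → (T x, T y) ∈ A.graph := Iff.rfl

theorem mem_commutant_iff_exists {A : E →ₗ.[ℂ] E} {T : E →L[ℂ] E} :
    T ∈ commutant A ↔ ∀ x : A.domain, ∃ h : T x ∈ A.domain, A ⟨T x, h⟩ = T (A x) := by
  rw [mem_commutant]
  constructor
  · intro hT x
    obtain ⟨z, hz, hz'⟩ := (LinearPMap.mem_graph_iff A).1 (hT _ _ (A.mem_graph x))
    have h : T x ∈ A.domain := by rw [← show (z : E) = T x from hz]; exact z.2
    refine ⟨h, ?_⟩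
    rw [← show A z = T (A x) from hz']
    congr 1
    exact Subtype.ext hz.symm
  · intro hT x y h
    obtain ⟨z, hz, hz'⟩ := (LinearPMap.mem_graph_iff A).1 h
    dsimp only at hz hz'
    subst hz hz'
    obtain ⟨h, h'⟩ := hT z
    exact (LinearPMap.mem_graph_iff A).2 ⟨⟨_, h⟩, rfl, h'⟩

theorem Commutes.mem_commutant {A : E →ₗ.[ℂ] E} {C : E →L[ℂ] E} (h : Commutes A C) :
    C ∈ commutant A := by
  rw [mem_commutant_iff_exists]
  intro x
  have hle : mulLeft (C : E →ₗ[ℂ] E) A ≤ mulRight A (C : E →ₗ[ℂ] E) := h.ge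
  have hx : (x : E) ∈ (mulRight A (C : E →ₗ[ℂ] E)).domain := hle.1 x.2
  exact ⟨hx, (hle.2 (x := x) (y := ⟨x, hx⟩) rfl).symm⟩

/-- For an involution the inclusion `C A ⊆ A C` suffices: applying `C` twice gives back the domain.
-/
theorem commutes_of_mem_commutant {A : E →ₗ.[ℂ] E} {C : E →L[ℂ] E} (hC : C * C = 1)
    (h : C ∈ commutant A) : Commutes A C := by
  rw [mem_commutant_iff_exists] at h
  have hCC (x : E) : C (C x) = x := congr($hC x)
  refine LinearPMap.ext ?_ ?_
  · refine Submodule.ext fun x => ⟨fun hx => ?_, fun hx => (h ⟨x, hx⟩).1⟩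
    obtain ⟨h', -⟩ := h ⟨C x, hx⟩
    rwa [hCC] at h'
  · intro x hx hx'
    exact (h ⟨x, hx'⟩).2

end Algebra

/-! ### Adjoints and self-adjoint operators. -/

section SelfAdjoint

variable {E : Type*} [NormedAddCommGroup E] [InnerProductSpace ℂ E] [CompleteSpace E]

theorem mem_commutant_adjoint {S : E →ₗ.[ℂ] E} (hS : Dense (S.domain : Set E)) {T : E →L[ℂ] E}
    (hT : star T ∈ commutant S) : T ∈ commutant S† := by
  rw [mem_commutant] at hT ⊢
  rw [LinearPMap.adjoint_graph_eq_graph_adjoint hS]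
  simp only [Submodule.mem_adjoint_iff]
  intro x y h a b hab
  have := h _ _ (hT _ _ hab)
  rwa [ContinuousLinearMap.star_eq_adjoint, ContinuousLinearMap.adjoint_inner_left,
    ContinuousLinearMap.adjoint_inner_left] at this

/-- For a self-adjoint operator `A`, the operator `A - i` is onto. -/
theorem exists_apply_sub_I_smul_eq {A : E →ₗ.[ℂ] E} (hA : IsSelfAdjoint A) (y : E) :
    ∃ x : A.domain, A x - Complex.I • (x : E) = y := by
  have hd := hA.dense_domain
  have hA' : A† = A := hA
  have hsymm : ∀ u v : A.domain, ⟪A u, (v : E)⟫_ℂ = ⟪(u : E), A v⟫_ℂ := by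
    have := LinearPMap.adjoint_isFormalAdjoint hd
    rwa [hA'] at this
  have hclosed : IsClosed (A.graph : Set (E × E)) := hA.isClosed
  have : CompleteSpace A.graph := hclosed.completeSpace_coe
  -- `A - i` is viewed on the graph of `A`, which is complete, rather than on `D(A)`.
  let f : A.graph →L[ℂ] E :=
    (ContinuousLinearMap.snd ℂ E E - Complex.I • ContinuousLinearMap.fst ℂ E E).comp
      A.graph.subtypeL
  have hf (x : A.domain) : f ⟨_, A.mem_graph x⟩ = A x - Complex.I • (x : E) := rfl
  -- The cross term drops out because `(A x, x)` is real.
  have hnorm (x : A.domain) :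
      ‖A x - Complex.I • (x : E)‖ ^ 2 = ‖A x‖ ^ 2 + ‖(x : E)‖ ^ 2 := by
    have him : (⟪A x, (x : E)⟫_ℂ).im = 0 := by
      have h1 : (starRingEnd ℂ) ⟪A x, (x : E)⟫_ℂ = ⟪A x, (x : E)⟫_ℂ := by
        rw [inner_conj_symm, hsymm]
      exact Complex.conj_eq_iff_im.1 h1
    rw [@norm_sub_sq ℂ, inner_smul_right, norm_smul]
    simp [him]
  have hanti : AntilipschitzWith 1 f := by
    refine AddMonoidHomClass.antilipschitz_of_bound f fun p => ?_
    obtain ⟨⟨a, b⟩, hp⟩ := p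
    obtain ⟨x, hx, hx'⟩ := (LinearPMap.mem_graph_iff A).1 hp
    dsimp only at hx hx'
    subst hx hx'
    rw [hf]
    have := hnorm x
    simp only [NNReal.coe_one, one_mul, Submodule.coe_norm, Prod.norm_mk]
    refine max_le ?_ ?_
    · refine le_of_sq_le_sq ?_ (norm_nonneg _)
      nlinarith [sq_nonneg ‖A x‖]
    · refine le_of_sq_le_sq ?_ (norm_nonneg _)
      nlinarith [sq_nonneg ‖(x : E)‖]
  have hrange : IsClosed (f.range : Set E) :=
    hanti.isClosed_range f.uniformContinuous
  have : CompleteSpace f.range := hrange.completeSpace_coe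
  -- A vector orthogonal to the range satisfies `A z = -i z`, which symmetry allows only for `z =
  -- 0`.
  have htop : f.range = ⊤ := by
    rw [← Submodule.orthogonal_eq_bot_iff, eq_bot_iff]
    intro z hz
    rw [Submodule.mem_orthogonal] at hz
    have hz' (x : A.domain) : ⟪A x, z⟫_ℂ - ⟪(x : E), (-Complex.I) • z⟫_ℂ = 0 := by
      have := hz _ ⟨⟨_, A.mem_graph x⟩, rfl⟩
      change ⟪A x - Complex.I • (x : E), z⟫_ℂ = 0 at this
      rw [inner_sub_left, inner_smul_left] at this
      rw [inner_smul_right]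
      simpa using this
    have hzA : (z, (-Complex.I) • z) ∈ A.graph := by
      rw [← hA', LinearPMap.adjoint_graph_eq_graph_adjoint hd, Submodule.mem_adjoint_iff]
      intro a b hab
      obtain ⟨x, hx, hx'⟩ := (LinearPMap.mem_graph_iff A).1 hab
      dsimp only at hx hx'
      subst hx hx'
      exact hz' x
    obtain ⟨x, hx, hx'⟩ := (LinearPMap.mem_graph_iff A).1 hzA
    dsimp only at hx hx'
    subst hx
    have h1 := hz' x
    have h2 := hsymm x x
    rw [hx', inner_smul_left, inner_smul_right] at h2
    have h3 : ⟪(x : E), (x : E)⟫_ℂ = 0 := by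
      have h4 : (2 * Complex.I) * ⟪(x : E), (x : E)⟫_ℂ = 0 := by
        simp only [map_neg, Complex.conj_I] at h2
        linear_combination h2
      exact (mul_eq_zero.1 h4).resolve_left (by simp)
    simpa using h3
  obtain ⟨⟨⟨a, b⟩, hp⟩, hy⟩ : y ∈ f.range := htop ▸ Submodule.mem_top
  obtain ⟨x, hx, hx'⟩ := (LinearPMap.mem_graph_iff A).1 hp
  dsimp only at hx hx'
  subst hx hx'
  exact ⟨x, hy⟩

/-- A `J`-self-adjoint operator that commutes with the involution `J` is self-adjoint. -/
theorem isSelfAdjoint_of_commutes {A : E →ₗ.[ℂ] E} {J : E →L[ℂ] E} (hJ : J * J = 1)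
    (hA : mulRight A† (J : E →ₗ[ℂ] E) = mulLeft (J : E →ₗ[ℂ] E) A) (hAJ : Commutes A J) :
    IsSelfAdjoint A := by
  -- `A† J = J A = A J`, and `J` on the right cancels because it is an involution.
  have h : mulRight A† (J : E →ₗ[ℂ] E) = mulRight A (J : E →ₗ[ℂ] E) := hA.trans hAJ.symm
  have hJJ (x : E) : J (J x) = x := congr($hJ x)
  rw [LinearPMap.isSelfAdjoint_def]
  have hmem (x : E) : x ∈ A†.domain ↔ x ∈ A.domain := by
    have := congr(J x ∈ LinearPMap.domain $h)
    change (J (J x) ∈ A†.domain) = (J (J x) ∈ A.domain) at this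
    rw [hJJ] at this
    exact iff_of_eq this
  refine LinearPMap.ext (Submodule.ext hmem) fun x hx hx' => ?_
  have h1 : J (J x) ∈ A†.domain := by rwa [hJJ]
  have h2 : J (J x) ∈ A.domain := by rwa [hJJ]
  have key : A† ⟨J (J x), h1⟩ = A ⟨J (J x), h2⟩ :=
    h.le.2 (x := ⟨J x, h1⟩) (y := ⟨J x, h2⟩) rfl
  simpa only [hJJ] using key

end SelfAdjoint

/-! ### Anticommuting involutions in dimension two. -/

section CliffordAlgebra

variable {E : Type*} [NormedAddCommGroup E] [InnerProductSpace ℂ E]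

/-- On a two-dimensional invariant subspace, two anticommuting involutions generate all linear
operators. -/
theorem exists_mem_adjoin_eqOn {J R : E →L[ℂ] E} (hJ : J * J = 1) (hR : R * R = 1)
    (hJR : J * R + R * J = 0) {N : Submodule ℂ E} (hN : Module.finrank ℂ N = 2)
    (hNJ : ∀ x ∈ N, J x ∈ N) (hNR : ∀ x ∈ N, R x ∈ N) {C : E →L[ℂ] E}
    (hNC : ∀ x ∈ N, C x ∈ N) :
    ∃ P ∈ Algebra.adjoin ℂ {J, R}, ∀ x ∈ N, C x = P x := by
  have hJJ (x : E) : J (J x) = x := congr($hJ x)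
  have hRR (x : E) : R (R x) = x := congr($hR x)
  have hJRx (x : E) : J (R x) = -R (J x) := eq_neg_of_add_eq_zero_left congr($hJR x)
  -- `v + J v` is fixed by `J`; if it vanishes, `J v = -v` and `R` carries `v` into the `+1`
  -- eigenspace.
  obtain ⟨e, heN, he0, heJ⟩ : ∃ e ∈ N, e ≠ 0 ∧ J e = e := by
    obtain ⟨v, hvN, hv0⟩ := N.exists_mem_ne_zero_of_ne_bot (by rintro rfl; simp at hN)
    by_cases hv : v + J v = 0
    · have hJv : J v = -v := by rw [eq_neg_iff_add_eq_zero, add_comm]; exact hv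
      refine ⟨R v, hNR v hvN, fun h => hv0 ?_, ?_⟩
      · rw [← hRR v, h, map_zero]
      · rw [hJRx, hJv, map_neg, neg_neg]
    · refine ⟨v + J v, N.add_mem hvN (hNJ v hvN), hv, ?_⟩
      rw [map_add, hJJ, add_comm]
  have hfJ : J (R e) = -R e := by rw [hJRx, heJ]
  have hli : LinearIndependent ℂ ![(⟨e, heN⟩ : N), ⟨R e, hNR e heN⟩] := by
    rw [LinearIndependent.pair_iff]
    intro s t hst
    have h1 : s • e + t • R e = 0 := congr(($hst : E))
    have h2 : s • e - t • R e = 0 := by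
      have := congr(J $h1)
      simpa [heJ, hfJ, sub_eq_add_neg] using this
    have h3 : s = 0 := by
      have : (2 * s) • e = 0 := by
        linear_combination (norm := module) h1 + h2
      simpa [he0] using this
    refine ⟨h3, ?_⟩
    have hf0 : R e ≠ 0 := fun h => he0 (by rw [← hRR e, h, map_zero])
    simpa [h3, hf0] using h1
  have hspan (x : E) (hx : x ∈ N) : ∃ s t : ℂ, s • e + t • R e = x := by
    have htop := hli.span_eq_top_of_card_eq_finrank (by simp [hN])
    have : (⟨x, hx⟩ : N) ∈ Submodule.span ℂ (Set.range ![(⟨e, heN⟩ : N), ⟨R e, hNR e heN⟩]) :=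
      htop ▸ Submodule.mem_top
    rw [Matrix.range_cons_cons_empty, Submodule.mem_span_pair] at this
    obtain ⟨s, t, h⟩ := this
    exact ⟨s, t, congr(($h : E))⟩
  obtain ⟨a, b, hab⟩ := hspan _ (hNC e heN)
  obtain ⟨c, d, hcd⟩ := hspan _ (hNC _ (hNR e heN))
  have hJm : J ∈ Algebra.adjoin ℂ {J, R} := Algebra.subset_adjoin (by simp)
  have hRm : R ∈ Algebra.adjoin ℂ {J, R} := Algebra.subset_adjoin (by simp)
  -- `(1 ± J) / 2` project onto the lines of `e` and `R e`; `a + b R` sends `e` to `C e`, and `d + c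
  -- R` sends `R e` to `C (R e)`.
  refine ⟨(a • 1 + b • R) * ((1 / 2 : ℂ) • (1 + J)) + (d • 1 + c • R) * ((1 / 2 : ℂ) • (1 - J)),
    ?_, fun x hx => ?_⟩
  · refine add_mem (mul_mem (add_mem ?_ ?_) ?_) (mul_mem (add_mem ?_ ?_) ?_) <;>
      refine Subalgebra.smul_mem _ ?_ _ <;> first | exact hRm | skip
    · exact one_mem _
    · exact add_mem (one_mem _) hJm
    · exact one_mem _
    · exact sub_mem (one_mem _) hJm
  · obtain ⟨s, t, rfl⟩ := hspan x hx
    simp only [map_add, map_smul, ← hab, ← hcd, add_apply,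
      mul_apply_eq_comp, smul_apply,
      one_apply_eq_self, sub_apply, heJ, hfJ, hRR, map_neg,
      map_sub, smul_neg, smul_add]
    module

end CliffordAlgebra

/-! ### Boundary images and Green's formula. -/

section Boundary

variable {E H : Type*} [NormedAddCommGroup E] [InnerProductSpace ℂ E] [CompleteSpace E]
  [NormedAddCommGroup H] [InnerProductSpace ℂ H]
  {S : E →ₗ.[ℂ] E}

namespace BoundaryTriplet

variable (B : BoundaryTriplet S H)

/-- Uniqueness is automatic because `Γ₀` is onto. -/
theorem hasImage_iff_exists {C : E →L[ℂ] E} : B.HasImage C ↔ ∃ K, B.Intertwines C K := by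
  refine ⟨ExistsUnique.exists, fun ⟨K, hK⟩ => ⟨K, hK, fun L hL => ?_⟩⟩
  ext a
  obtain ⟨f, hf⟩ := B.surj (a, 0)
  have hf0 : B.Γ₀ f = a := congr(($hf).1)
  rw [← hf0]
  exact (hL f).2.1.trans (hK f).2.1.symm

/-- The algebra of the bounded operators that have a boundary image. -/
def imageAlgebra : Subalgebra ℂ (E →L[ℂ] E) where
  carrier := {C | ∃ K, B.Intertwines C K}
  mul_mem' := by
    rintro C D ⟨K, hK⟩ ⟨L, hL⟩
    refine ⟨K * L, fun f => ?_⟩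
    obtain ⟨h, h0, h1⟩ := hL f
    obtain ⟨h', h0', h1'⟩ := hK ⟨_, h⟩
    refine ⟨h', ?_, ?_⟩
    · rw [mul_apply_eq_comp, h0, h0']; rfl
    · rw [mul_apply_eq_comp, h1, h1']; rfl
  add_mem' := by
    rintro C D ⟨K, hK⟩ ⟨L, hL⟩
    refine ⟨K + L, fun f => ?_⟩
    obtain ⟨h, h0, h1⟩ := hL f
    obtain ⟨h', h0', h1'⟩ := hK f
    refine ⟨add_mem h' h, ?_, ?_⟩
    · rw [add_apply, h0, h0', ← map_add]; rfl
    · rw [add_apply, h1, h1', ← map_add]; rfl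
  algebraMap_mem' c := by
    refine ⟨algebraMap ℂ _ c, fun f => ⟨Submodule.smul_mem _ c f.2, ?_, ?_⟩⟩
    · exact (B.Γ₀.map_smul c f).symm
    · exact (B.Γ₁.map_smul c f).symm

theorem mem_imageAlgebra {C : E →L[ℂ] E} : C ∈ B.imageAlgebra ↔ B.HasImage C :=
  B.hasImage_iff_exists.symm

/-- Test elements with boundary values `(0, Γ₀ f)` and `(Γ₁ f, 0)` turn the form into `-‖Γ₀ f‖²` and
`‖Γ₁ f‖²`. -/
theorem eq_zero_of_forall_green {f : S†.domain}
    (hf : ∀ h : S†.domain, ⟪(h : E), S† f⟫_ℂ - ⟪S† h, (f : E)⟫_ℂ = 0) :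
    B.Γ₀ f = 0 ∧ B.Γ₁ f = 0 := by
  simp only [B.green] at hf
  constructor
  · obtain ⟨h, hh⟩ := B.surj (0, B.Γ₀ f)
    have h0 : B.Γ₀ h = 0 := congr(($hh).1)
    have h1 : B.Γ₁ h = B.Γ₀ f := congr(($hh).2)
    simpa [h0, h1] using hf h
  · obtain ⟨h, hh⟩ := B.surj (B.Γ₁ f, 0)
    have h0 : B.Γ₀ h = B.Γ₁ f := congr(($hh).1)
    have h1 : B.Γ₁ h = 0 := congr(($hh).2)
    simpa [h0, h1] using hf h

end BoundaryTriplet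

theorem mem_map_defectSpace {μ : ℂ} {x : E} :
    x ∈ (defectSpace S μ).map S†.domain.subtype ↔ (x, μ • x) ∈ S†.graph := by
  simp only [Submodule.mem_map, LinearPMap.mem_graph_iff, defectSpace, LinearMap.mem_ker,
    LinearMap.sub_apply, sub_eq_zero, LinearMap.smul_apply]
  constructor
  · rintro ⟨y, hy, rfl⟩
    exact ⟨y, rfl, hy⟩
  · rintro ⟨y, rfl, hy⟩
    exact ⟨y, hy, rfl⟩

/-- An operator that commutes with a self-adjoint extension of `S`, commutes with `S` together with
its adjoint, and vanishes on `ker (S* - i)`, has the boundary image `0`. -/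
theorem BoundaryTriplet.intertwines_zero (B : BoundaryTriplet S H)
    (hS : IsSymmetricOp S) {A : E →ₗ.[ℂ] E} (hA : IsSelfAdjoint A) (hSA : S ≤ A)
    {T : E →L[ℂ] E} (hTS : T ∈ commutant S) (hTS' : star T ∈ commutant S) (hTA : T ∈ commutant A)
    (hT : ∀ x, (x, Complex.I • x) ∈ S†.graph → T x = 0) : B.Intertwines T 0 := by
  have hA' : A† = A := hA
  have hT1 : T ∈ commutant S† := mem_commutant_adjoint hS.dense hTS'
  have hT2 : star T ∈ commutant S† :=
    mem_commutant_adjoint hS.dense (by rwa [star_star])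
  have hASg : ∀ p ∈ A.graph, p ∈ S†.graph := by
    rintro ⟨x, y⟩ hp
    rw [← hA', LinearPMap.adjoint_graph_eq_graph_adjoint hA.dense_domain] at hp
    rw [LinearPMap.adjoint_graph_eq_graph_adjoint hS.dense]
    rw [Submodule.mem_adjoint_iff] at hp ⊢
    exact fun a b hab => hp a b (LinearPMap.le_graph_of_le hSA hab)
  have hsymm : ∀ x y u v, (x, y) ∈ A.graph → (u, v) ∈ A.graph → ⟪v, x⟫_ℂ - ⟪u, y⟫_ℂ = 0 := by
    intro x y u v h1 h2
    rw [← hA', LinearPMap.adjoint_graph_eq_graph_adjoint hA.dense_domain,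
      Submodule.mem_adjoint_iff] at h1
    exact h1 _ _ h2
  -- `T*` preserves `ker (S* - i)`, which `T` kills, so `‖T* x‖² = (T T* x, x) = 0`.
  have hTstar : ∀ x, (x, Complex.I • x) ∈ S†.graph → star T x = 0 := by
    intro x hx
    have hx' := hT2 _ _ hx
    rw [map_smul] at hx'
    have := hT _ hx'
    rw [← inner_self_eq_zero (𝕜 := ℂ), ContinuousLinearMap.star_eq_adjoint,
      ContinuousLinearMap.adjoint_inner_left, ← ContinuousLinearMap.star_eq_adjoint, this,
      inner_zero_right]
  -- `D(S*) = D(A) + ker (S* - i)`: solve `(A - i) u = (S* - i) x` and take `n = x - u`.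
  have hdecomp (x y : E) (h : (x, y) ∈ S†.graph) : ∃ u v n, (u, v) ∈ A.graph ∧
      (n, Complex.I • n) ∈ S†.graph ∧ x = u + n ∧ y = v + Complex.I • n := by
    obtain ⟨u, hu⟩ := exists_apply_sub_I_smul_eq hA (y - Complex.I • x)
    refine ⟨u, A u, x - u, A.mem_graph u, ?_, by abel, ?_⟩
    · have h1 := S†.graph.sub_mem h (hASg _ (A.mem_graph u))
      convert h1 using 1
      ext
      · rfl
      · simp only [Prod.snd_sub]
        rw [smul_sub, eq_sub_iff_add_eq, ← sub_eq_zero]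
        linear_combination (norm := module) hu
    · linear_combination (norm := module) -hu
  intro f
  obtain ⟨h, hTf⟩ := mem_commutant_iff_exists.1 hT1 f
  refine ⟨h, ?_⟩
  suffices H : ∀ g : S†.domain, ⟪(g : E), S† ⟨T f, h⟩⟫_ℂ - ⟪S† g, T f⟫_ℂ = 0 by
    obtain ⟨h0, h1⟩ := B.eq_zero_of_forall_green H
    simp [h0, h1]
  intro g
  rw [hTf]
  obtain ⟨u, v, n, huv, hn, hf1, hf2⟩ := hdecomp _ _ (S†.mem_graph f)
  obtain ⟨w, z, m, hwz, hm, hg1, hg2⟩ := hdecomp _ _ (S†.mem_graph g)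
  have e1 : ⟪m, T v⟫_ℂ = 0 := by
    rw [← ContinuousLinearMap.adjoint_inner_left, ← ContinuousLinearMap.star_eq_adjoint,
      hTstar m hm, inner_zero_left]
  have e2 : ⟪m, T u⟫_ℂ = 0 := by
    rw [← ContinuousLinearMap.adjoint_inner_left, ← ContinuousLinearMap.star_eq_adjoint,
      hTstar m hm, inner_zero_left]
  -- With `T n = 0` and `T* m = 0`, only the `D(A)` components `u`, `w` contribute, and these cancel
  -- by the symmetry of `A`.
  have e3 := hsymm _ _ _ _ (hTA _ _ huv) hwz
  rw [hf1, hf2, hg1, hg2]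
  simp only [map_add, map_smul, hT n hn, smul_zero, add_zero, inner_add_left, inner_smul_left,
    e1, e2, mul_zero]
  linear_combination -e3

end Boundary

/-! ### Explicit `C`-symmetries built from `J` and `R`. -/

section Symmetries

variable {E : Type*} [NormedAddCommGroup E] [InnerProductSpace ℂ E] [CompleteSpace E]
  {S : E →ₗ.[ℂ] E} {J R : E →L[ℂ] E}

theorem self_mem_cSymmetries (hJ : IsFundamentalSymmetry J) (hSJ : Commutes S J) :
    J ∈ cSymmetries S J := by
  refine ⟨hJ.sq, ⟨by rw [hJ.sq]; exact IsSelfAdjoint.one _, fun x hx => ?_⟩, hSJ⟩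
  rw [hJ.sq, ContinuousLinearMap.reApplyInnerSelf_apply]
  rw [one_apply_eq_self, inner_self_eq_norm_sq (𝕜 := ℂ)]
  exact pow_pos (norm_pos_iff.2 hx) 2

/-- Used to see that `C*` lies in the commutant of `S` whenever `C` is a `C`-symmetry. -/
theorem star_eq_of_mem_cSymmetries (hJ : IsFundamentalSymmetry J) {C : E →L[ℂ] E}
    (hC : C ∈ cSymmetries S J) : star C = J * C * J := by
  have h : star (J * C) = J * C := hC.2.1.1
  have hJ' : star J = J := hJ.selfAdjoint
  rw [star_mul, hJ'] at h
  rw [← h, mul_assoc, hJ.sq, mul_one]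

theorem norm_apply_of_isFundamentalSymmetry (hR : IsFundamentalSymmetry R) (x : E) :
    ‖R x‖ = ‖x‖ := by
  have hR' : star R = R := hR.selfAdjoint
  have h : ⟪R x, R x⟫_ℂ = ⟪x, x⟫_ℂ := by
    rw [← ContinuousLinearMap.adjoint_inner_right, ← ContinuousLinearMap.star_eq_adjoint, hR',
      ← mul_apply_eq_comp, hR.sq, one_apply_eq_self]
  rw [inner_self_eq_norm_sq_to_K, inner_self_eq_norm_sq_to_K] at h
  have h' : ‖R x‖ ^ 2 = ‖x‖ ^ 2 := by exact_mod_cast h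
  exact (sq_eq_sq₀ (norm_nonneg _) (norm_nonneg _)).1 h'

/-- The `C`-symmetry `J e^{χ R}` with `cosh χ = 5/4` and `sinh χ = 3/4`. -/
theorem mul_add_mem_cSymmetries (hJ : IsFundamentalSymmetry J) (hR : IsFundamentalSymmetry R)
    (hJR : J * R + R * J = 0) (hSJ : Commutes S J) (hSR : Commutes S R) :
    J * ((5 / 4 : ℂ) • 1 + (3 / 4 : ℂ) • R) ∈ cSymmetries S J := by
  have hJ' : star J = J := hJ.selfAdjoint
  have hR' : star R = R := hR.selfAdjoint
  have hRJ : R * J = -(J * R) := eq_neg_of_add_eq_zero_right hJR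
  -- `J e^{χR} J = e^{-χR}` by anticommutation; numerically, `(5/4)² - (3/4)² = 1`.
  have hsq : J * ((5 / 4 : ℂ) • 1 + (3 / 4 : ℂ) • R) * (J * ((5 / 4 : ℂ) • 1 + (3 / 4 : ℂ) • R))
      = 1 := by
    have h1 : J * R * J = -R := by
      rw [mul_assoc, hRJ, mul_neg, ← mul_assoc, hJ.sq, one_mul]
    have h2 : J * R * (J * R) = -1 := by
      rw [← mul_assoc, h1, neg_mul, hR.sq]
    have h3 : J * (J * R) = R := by rw [← mul_assoc, hJ.sq, one_mul]
    simp only [mul_add, add_mul, mul_smul_comm, smul_mul_assoc, mul_one, hJ.sq, h1, h2, h3]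
    module
  have hJC : J * (J * ((5 / 4 : ℂ) • 1 + (3 / 4 : ℂ) • R)) = (5 / 4 : ℂ) • 1 + (3 / 4 : ℂ) • R := by
    rw [← mul_assoc, hJ.sq, one_mul]
  refine ⟨hsq, ?_, commutes_of_mem_commutant hsq (mul_mem hSJ.mem_commutant (add_mem ?_ ?_))⟩
  · rw [hJC]
    refine ⟨?_, fun x hx => ?_⟩
    · rw [IsSelfAdjoint, star_add, star_smul, star_smul, hR', star_one]
      simp
    · rw [ContinuousLinearMap.reApplyInnerSelf_apply]
      -- `R` is isometric, so `5/4 + (3/4) R` is bounded below by `5/4 - 3/4 = 1/2`.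
      have h1 : |(⟪R x, x⟫_ℂ).re| ≤ ‖x‖ * ‖x‖ := by
        refine (Complex.abs_re_le_norm _).trans ((norm_inner_le_norm _ _).trans ?_)
        rw [norm_apply_of_isFundamentalSymmetry hR]
      have h2 : 0 < ‖x‖ := norm_pos_iff.2 hx
      have h3 : (⟪x, x⟫_ℂ).re = ‖x‖ * ‖x‖ := by
        have := inner_self_eq_norm_mul_norm (𝕜 := ℂ) x
        simpa using this
      have h4 : RCLike.re ⟪((5 / 4 : ℂ) • 1 + (3 / 4 : ℂ) • R : E →L[ℂ] E) x, x⟫_ℂ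
          = 5 / 4 * (‖x‖ * ‖x‖) + 3 / 4 * (⟪R x, x⟫_ℂ).re := by
        rw [add_apply, smul_apply,
          smul_apply, one_apply_eq_self, inner_add_left,
          inner_smul_left, inner_smul_left, ← h3,
          show (starRingEnd ℂ) (5 / 4 : ℂ) = ((5 / 4 : ℝ) : ℂ) by
            rw [← Complex.conj_ofReal]; norm_num,
          show (starRingEnd ℂ) (3 / 4 : ℂ) = ((3 / 4 : ℝ) : ℂ) by
            rw [← Complex.conj_ofReal]; norm_num, map_add]
        exact congr_arg₂ _ (Complex.re_ofReal_mul _ _) (Complex.re_ofReal_mul _ _)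
      rw [h4]
      nlinarith [(abs_le.1 h1).1, mul_pos h2 h2]
  · exact Subalgebra.smul_mem _ (one_mem _) _
  · exact Subalgebra.smul_mem _ hSR.mem_commutant _

/-- An algebra that contains every `C`-symmetry contains `R`. -/
theorem mem_of_cSymmetries_subset (hJ : IsFundamentalSymmetry J) (hR : IsFundamentalSymmetry R)
    (hJR : J * R + R * J = 0) (hSJ : Commutes S J) (hSR : Commutes S R)
    {M : Subalgebra ℂ (E →L[ℂ] E)} (hM : cSymmetries S J ⊆ M) : R ∈ M := by
  have hJM : J ∈ M := hM (self_mem_cSymmetries hJ hSJ)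
  have hCM := hM (mul_add_mem_cSymmetries hJ hR hJR hSJ hSR)
  have h : R = (4 / 3 : ℂ) • (J * (J * ((5 / 4 : ℂ) • 1 + (3 / 4 : ℂ) • R)))
      - (5 / 3 : ℂ) • (1 : E →L[ℂ] E) := by
    rw [← mul_assoc, hJ.sq, one_mul]
    module
  rw [h]
  exact sub_mem (Subalgebra.smul_mem _ (mul_mem hJM hCM) _) (Subalgebra.smul_mem _ (one_mem _) _)

end Symmetries

end KreinExt

/-! ### The equivalence. -/

open KreinExt in
theorem corollary4p2
    {E H : Type*} [NormedAddCommGroup E] [InnerProductSpace ℂ E] [CompleteSpace E]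
    [NormedAddCommGroup H] [InnerProductSpace ℂ H] [CompleteSpace H]
    (J R : E →L[ℂ] E)
    (hJ : KreinExt.IsFundamentalSymmetry J) (hR : KreinExt.IsFundamentalSymmetry R)
    (hJR : J * R + R * J = 0)
    (S : E →ₗ.[ℂ] E) (hS : KreinExt.IsSymmetricOp S)
    (hsimple : KreinExt.IsSimpleOp S) (hdef : KreinExt.HasDefectNumbers S 2 2)
    (hSJ : KreinExt.Commutes S J) (hSR : KreinExt.Commutes S R)
    (hΥ : (KreinExt.upsilonSet S J).Nonempty)
    (B : KreinExt.BoundaryTriplet S H) :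
    B.HasIntertwiningProperty J ↔ B.HasImage J ∧ B.HasImage R := by
  have hJ' : star J = J := hJ.selfAdjoint
  have hR' : star R = R := hR.selfAdjoint
  constructor
  · intro h
    refine ⟨h J (self_mem_cSymmetries hJ hSJ), B.mem_imageAlgebra.1 ?_⟩
    exact mem_of_cSymmetries_subset hJ hR hJR hSJ hSR fun C hC => B.mem_imageAlgebra.2 (h C hC)
  · rintro ⟨hBJ, hBR⟩ C hC
    obtain ⟨A, ⟨hSA, hAJ⟩, hAC⟩ := hΥ
    have hJC := self_mem_cSymmetries hJ hSJ
    have hA : IsSelfAdjoint A := isSelfAdjoint_of_commutes hJ.sq hAJ (hAC J hJC)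
    have hJA : J ∈ commutant A := (hAC J hJC).mem_commutant
    -- `Υ` only provides commutation with `C`-symmetries; `R` is reached because they generate it.
    have hRA : R ∈ commutant A :=
      mem_of_cSymmetries_subset hJ hR hJR hSJ hSR fun C hC => (hAC C hC).mem_commutant
    have hJS := hSJ.mem_commutant
    have hRS := hSR.mem_commutant
    have hCS : C ∈ commutant S := hC.2.2.mem_commutant
    have hCS' : star C ∈ commutant S := by
      rw [star_eq_of_mem_cSymmetries hJ hC]
      exact mul_mem (mul_mem hJS hCS) hJS
    have hinv {T : E →L[ℂ] E} (hT : star T ∈ commutant S) (x : E)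
        (hx : x ∈ (defectSpace S Complex.I).map S†.domain.subtype) :
        T x ∈ (defectSpace S Complex.I).map S†.domain.subtype := by
      rw [mem_map_defectSpace] at hx ⊢
      rw [← map_smul]
      exact mem_commutant_adjoint hS.dense hT _ _ hx
    have hfin : Module.finrank ℂ ((defectSpace S Complex.I).map S†.domain.subtype) = 2 := by
      rw [← hdef.1]
      exact Submodule.finrank_map_subtype_eq _ _
    obtain ⟨P, hP, hCP⟩ := exists_mem_adjoin_eqOn hJ.sq hR.sq hJR hfin (hinv (by rwa [hJ']))
      (hinv (by rwa [hR'])) (hinv hCS')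
    have hadj {M : Subalgebra ℂ (E →L[ℂ] E)} (hJM : J ∈ M) (hRM : R ∈ M) : P ∈ M :=
      Algebra.adjoin_le (by rintro T (rfl | rfl) <;> assumption) hP
    -- The adjoints of the members of `commutant S` form an algebra too, and it contains the
    -- self-adjoint `J` and `R`.
    have hPS : star P ∈ commutant S := by
      have : P ∈ star (commutant S) :=
        hadj (Subalgebra.mem_star_iff _ _ |>.2 (by rwa [hJ']))
          (Subalgebra.mem_star_iff _ _ |>.2 (by rwa [hR']))
      rwa [Subalgebra.mem_star_iff] at this
    have hT : C - P ∈ B.imageAlgebra := by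
      refine ⟨0, B.intertwines_zero hS hA hSA (sub_mem hCS (hadj hJS hRS)) ?_
        (sub_mem (hAC C hC).mem_commutant (hadj hJA hRA)) fun x hx => ?_⟩
      · rw [star_sub]
        exact sub_mem hCS' hPS
      · rw [sub_apply, hCP x (mem_map_defectSpace.2 hx), sub_self]
    rw [← B.mem_imageAlgebra, ← sub_add_cancel C P]
    exact add_mem hT (hadj (B.mem_imageAlgebra.2 hBJ) (B.mem_imageAlgebra.2 hBR))
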